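/- Let \(L_{\mathrm{LA}} = \{0, s, p, +\}\) be the first-order language with equality whose function symbols are a constant \(0\), unary \(s\) and \(p\), and binary \(+\). Let \(B\) be the \(L_{\mathrm{LA}}\) theory axiomatized by the universal closures of \[ s(0) \neq 0,\quad p(0) = 0,\quad p(s(x)) = x,\quad x + 0 = x,\quad x + s(y) = s(x+y), \] and let \(\mathrm{B2}\) and \(\mathrm{B3}\) be the universal closures of \(x + y = y + x\) and \(x + (y + z) = (x + y) + z\), respectively. Write \(T \vdash \sigma\) if the sentence \(\sigma\) is provable in classical first-order logic with equality from the set \(T\) of axioms. Let \(R\) be the parameter-free \(\exists_1\) induction rule: for every formula \(\gamma(x)\) of the form \(\exists \vec y\, \psi(x, \vec y)\) with \(\psi\) a quantifier-free \(L_{\mathrm{LA}}\) formula and with no free variable other than \(x\), the rule infers \(\forall x\, \gamma(x)\) from the two premises \(\gamma(0)\) and \(\forall x\,(\gamma(x) \rightarrow \gamma(s(x)))\). For a theory \(T\) let \([T,R]\) be \(T\) together with the conclusions of all instances of \(R\) whose premises are provable from \(T\); let \([T,R]_0 = T\), \([T,R]_{n+1} = [[T,R]_n, R]\), and \(T + R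 = \bigcup_{n \ge 0} [T,R]_n\) (nested applications of \(R\)). Let \(M_2\) be the \(L_{\mathrm{LA}}\) structure whose elements are the pairs \((m,n) \in \{0,1,2\} \times \mathbb{Z}\) such that \(n \geq 0\) if \(m = 0\) (so besides the standard elements, those with \(m = 0\), it has two nonstandard chains, \(m = 1\) and \(m = 2\)), with \[ 0^{M_2} = (0,0),\qquad s^{M_2}(m,n) = (m,n+1),\qquad p^{M_2}(0,n) = (0,\max(n-1,0)),\qquad p^{M_2}(m,n) = (m,n-1) \text{ for } m \neq 0, \] and \((m_1,n_1) +^{M_2} (m_2,n_2) = (m, n_1+n_2)\), where \(m = m_1\) if \(m_1 \neq 0\) and \(m = m_2\) if \(m_1 = 0\). Then: 1. \((B + \mathrm{B3}) + R \not\vdash \mathrm{B2}\). 2. \(M_2\) is a model of \((B + \mathrm{B3}) + R\) in which \(\mathrm{B2}\) is false. 3. Consequently, omitting \(\mathrm{B2}\) yields a strictly weaker theory: the set of sentences provable from \((B + \mathrm{B3}) + R\) is a proper subset of the set of sentences provable from \((B + \mathrm{B2} + \mathrm{B3}) + R\). -/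

import Mathlib

open scoped FirstOrder

namespace LinArith

open FirstOrder FirstOrder.Language

/-! ### Provability in first-order logic with equality

Formulas have the variables `0, 1, 2, …` of type `ℕ` as free variables. The primitive logical
symbols are `⊥`, `→`, `∀` and `=`. -/

section Provability

variable {L : FirstOrder.Language.{0, 0}}

/-- The (capture-avoiding) result `φ(t)` of substituting the term `t` for the variable `x` that is
bound by the outermost quantifier of `∀ x, φ`. -/
def inst (φ : L.BoundedFormula ℕ 1) (t : L.Term ℕ) : L.Formula ℕ :=
  φ.toFormula.subst (Sum.elim Term.var fun _ => t)

/-- `Derivable T φ`: the formula `φ` is derivable from the axioms `T` in a Hilbert-style calculus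
for classical first-order logic with equality. -/
inductive Derivable (T : L.Theory) : L.Formula ℕ → Prop
  | axm {σ : L.Sentence} (h : σ ∈ T) : Derivable T (Formula.relabel Empty.elim σ)
  | imp_k (φ ψ : L.Formula ℕ) : Derivable T (φ.imp (ψ.imp φ))
  | imp_s (φ ψ χ : L.Formula ℕ) :
      Derivable T ((φ.imp (ψ.imp χ)).imp ((φ.imp ψ).imp (φ.imp χ)))
  | not_not (φ : L.Formula ℕ) : Derivable T (φ.not.not.imp φ)
  | mp {φ ψ : L.Formula ℕ} (h₁ : Derivable T (φ.imp ψ)) (h₂ : Derivable T φ) : Derivable T ψ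
  | all_elim (φ : L.BoundedFormula ℕ 1) (t : L.Term ℕ) : Derivable T (φ.all.imp (inst φ t))
  | all_intro {ψ : L.Formula ℕ} {φ : L.BoundedFormula ℕ 1} {a : ℕ}
      (hψ : a ∉ ψ.freeVarFinset) (hφ : a ∉ φ.freeVarFinset)
      (h : Derivable T (ψ.imp (inst φ (Term.var a)))) : Derivable T (ψ.imp φ.all)
  | eq_refl (t : L.Term ℕ) : Derivable T (t.equal t)
  | eq_subst (φ : L.BoundedFormula ℕ 1) (s t : L.Term ℕ) :
      Derivable T ((s.equal t).imp ((inst φ s).imp (inst φ t)))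

/-- `Proves T σ`, that is `T ⊢ σ`, for a sentence `σ`. -/
def Proves (T : L.Theory) (σ : L.Sentence) : Prop :=
  Derivable T (Formula.relabel Empty.elim σ)

/-! ### Inference rules -/

variable (L) in
/-- An inference rule is a set of instances `Γ / γ`, where `Γ` is a finite collection of sentences
(the premises) and `γ` is a sentence (the conclusion). -/
abbrev InferenceRule := Set (List L.Sentence × L.Sentence)

/-- The theory `[T, R]` of unnested applications of the rule `R` over `T`. -/
def unnested (T : L.Theory) (R : InferenceRule L) : L.Theory :=
  T ∪ {σ | ∃ Γ : List L.Sentence, (Γ, σ) ∈ R ∧ ∀ γ ∈ Γ, Proves T γ}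

/-- The theories `[T, R]₀ = T` and `[T, R]ₙ₊₁ = [[T, R]ₙ, R]`. -/
def nestedUpTo (T : L.Theory) (R : InferenceRule L) : ℕ → L.Theory
  | 0 => T
  | n + 1 => unnested (nestedUpTo T R n) R

/-- The theory `T + R = ⋃ₙ [T, R]ₙ` of nested applications of the rule `R` over `T`. -/
def addRule (T : L.Theory) (R : InferenceRule L) : L.Theory :=
  ⋃ n : ℕ, nestedUpTo T R n

/-- The universal closure `∀ x, φ(x)` of a formula `φ(x)` with the only free variable `x`. -/
def forallClosure (φ : L.Formula (Fin 1)) : L.Sentence :=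
  BoundedFormula.alls (n := 1) (BoundedFormula.relabel (n := 1) (k := 0) Sum.inr φ)

end Provability

/-! ### Linear arithmetic -/

/-- The function symbols `0`, `s`, `p`, `+`. -/
inductive Func : ℕ → Type
  | zero : Func 0
  | succ : Func 1
  | pred : Func 1
  | add : Func 2

/-- The language `{0, s, p, +}` of linear arithmetic. -/
abbrev LA : FirstOrder.Language.{0, 0} := ⟨Func, fun _ => Empty⟩

section Terms

variable {α : Type}

/-- The term `0`. -/
def zeroT : LA.Term α := Constants.term (L := LA) Func.zero

/-- The term `s(t)`. -/
def succT (t : LA.Term α) : LA.Term α := Functions.apply₁ (L := LA) Func.succ t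

/-- The term `p(t)`. -/
def predT (t : LA.Term α) : LA.Term α := Functions.apply₁ (L := LA) Func.pred t

/-- The term `t + u`. -/
def addT (t u : LA.Term α) : LA.Term α := Functions.apply₂ (L := LA) Func.add t u

end Terms

/-- The base theory `B`: the universal closures of `s(0) ≠ 0`, `p(0) = 0`, `p(s(x)) = x`,
`x + 0 = x` and `x + s(y) = s(x + y)`. -/
def baseB : LA.Theory :=
  {∼(succT zeroT =' zeroT),
   predT zeroT =' zeroT,
   ∀' (predT (succT (&0)) =' &0),
   ∀' (addT (&0) zeroT =' &0),
   ∀' ∀' (addT (&0) (succT (&1)) =' succT (addT (&0) (&1)))}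

/-- Commutativity of addition (the formula B2): `∀ x y, x + y = y + x`. -/
def axiomB2 : LA.Sentence := ∀' ∀' (addT (&0) (&1) =' addT (&1) (&0))

/-- Associativity of addition (the formula B3): `∀ x y z, x + (y + z) = (x + y) + z`. -/
def axiomB3 : LA.Sentence :=
  ∀' ∀' ∀' (addT (&0) (addT (&1) (&2)) =' addT (addT (&0) (&1)) (&2))

/-- The parameter-free induction rule for a set `Γ` of formulas `γ(x)` with the only free
variable `x`: from `γ(0)` and `∀ x, (γ(x) → γ(s(x)))` infer `∀ x, γ(x)`. -/
def parameterFreeInductionRule (Γ : Set (LA.Formula (Fin 1))) : InferenceRule LA :=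
  {i | ∃ γ ∈ Γ, i =
    ([γ.subst (fun _ => zeroT),
      forallClosure (γ.imp (γ.subst fun x => succT (Term.var x)))],
     forallClosure γ)}

/-- The `∃₁` formulas of linear arithmetic in the only free variable `x`: those of the form
`∃ y₁ … yₖ, ψ` with `k ≥ 0` and `ψ` quantifier-free. -/
def existsOne : Set (LA.Formula (Fin 1)) := {γ | BoundedFormula.IsExistential γ}

/-! ### The structures `M_I` -/

/-- The operation on types of elements: `m` if `m ≠ 0`, and `n` if `m = 0`. -/
def typeOp (m n : ℕ) : ℕ := if m = 0 then n else m

/-- The domain of `M_I`: the pairs `(m, n) ∈ ℕ × ℤ` with `m ≤ I`, and `n ≥ 0` if `m = 0`.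
For `m = 0` these are the standard elements; each `m` with `1 ≤ m ≤ I` gives one nonstandard
chain. -/
def M (I : ℕ) : Type := {a : ℕ × ℤ // a.1 ≤ I ∧ (a.1 = 0 → 0 ≤ a.2)}

namespace M

variable {I : ℕ}

/-- The interpretation of `0`. -/
def zero : M I := ⟨(0, 0), by simp⟩

/-- The interpretation of `s`. -/
def succ (a : M I) : M I :=
  ⟨(a.1.1, a.1.2 + 1), a.2.1, fun h => by have := a.2.2 h; simp only; omega⟩

/-- The interpretation of `p`. -/
def pred (a : M I) : M I :=
  ⟨(a.1.1, if a.1.1 = 0 then max (a.1.2 - 1) 0 else a.1.2 - 1), a.2.1, fun h => by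
    simp only at h
    simp [h]⟩

/-- The interpretation of `+`. -/
def add (a b : M I) : M I :=
  ⟨(typeOp a.1.1 b.1.1, a.1.2 + b.1.2), by
    have ha := a.2
    have hb := b.2
    simp only [typeOp]
    split_ifs with h
    · exact ⟨hb.1, fun h' => add_nonneg (ha.2 h) (hb.2 h')⟩
    · exact ⟨ha.1, fun h' => absurd h' h⟩⟩

instance : LA.Structure (M I) where
  funMap
    | Func.zero, _ => zero
    | Func.succ, v => succ (v 0)
    | Func.pred, v => pred (v 0)
    | Func.add, v => add (v 0) (v 1)
  RelMap := fun r _ => Empty.elim r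

end M

end LinArith

/-! A sum of elements of two different nonstandard chains lies in the chain of the left summand, so
B2 fails in `M 2`. By soundness, it remains to see that every `M I` satisfies all conclusions of the
rule (`models_nestedUpTo`).

The premises of an instance hold in `M 0`, the standard model, so γ holds at every natural number
and, by Łoś, at an infinite element ω of an ultrapower. As γ is existential, its truth at ω rests on
finitely many elements (`exists_finset_realize_of_isExistential`). Their values lie in a finitely
generated group of nonstandard integers with ℤ·1 as a direct summand. A retraction h onto ℤ sends
the nonstandard ones into a single chain m of `M I`, while standard elements stay fixed
(`isPartialEmbeddingOn_toM`); a single chain never exhibits noncommutativity. There is enough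
freedom to make h injective on these values and h(ω) as negative as desired
(`exists_partial_retraction`). So γ holds arbitrarily far down each chain, and the induction step,
true in `M I`, carries it upwards to the whole chain. -/

namespace LinArith

open FirstOrder FirstOrder.Language

/-! ### Retractions of abelian groups onto a cyclic subgroup -/

section Retraction

variable {A : Type*} [AddCommGroup A]

/-- The affine line `h + c • μ` meets the hyperplanes given by finitely many vectors, none of which
contains it, only finitely often. -/
theorem finite_setOf_exists_affine_eq_zero (h μ : A →ₗ[ℤ] ℤ) (D : Finset A)
    (hD : ∀ d ∈ D, h d ≠ 0 ∨ μ d ≠ 0) : {c : ℤ | ∃ d ∈ D, h d + c * μ d = 0}.Finite := by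
  have : {c : ℤ | ∃ d ∈ D, h d + c * μ d = 0} = ⋃ d ∈ D, {c : ℤ | h d + c * μ d = 0} := by
    ext; simp
  rw [this]
  refine D.finite_toSet.biUnion fun d hd => Set.Subsingleton.finite fun a ha b hb => ?_
  simp only [Set.mem_ofPred_eq] at ha hb
  by_cases hμ : μ d = 0
  · simp_all
    exact absurd ha (by grind)
  · exact mul_right_cancel₀ hμ (by linarith)

/-- If `A` is finitely generated, `e` has infinite order and `A ⧸ ℤ e` is torsion-free, then
there is a retraction of `A` onto `ℤ e` that is nonzero at finitely many given elements outside
`ℤ e` and as small as we please at another such element. -/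
theorem exists_retraction [Module.Finite ℤ A] {e : A} (he : ∀ n : ℤ, n • e = 0 → n = 0)
    (tf : ∀ (n : ℤ) (a : A), n ≠ 0 → n • a ∈ Submodule.span ℤ {e} → a ∈ Submodule.span ℤ {e})
    (D : Finset A) (hD : ∀ d ∈ D, d ∉ Submodule.span ℤ {e}) {x : A}
    (hx : x ∉ Submodule.span ℤ {e}) (K : ℤ) :
    ∃ h : A →ₗ[ℤ] ℤ, h e = 1 ∧ (∀ d ∈ D, h d ≠ 0) ∧ h x < K := by
  classical
  set P := Submodule.span ℤ {e} with hP
  have htf : Module.IsTorsionFree ℤ (A ⧸ P) := by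
    rw [Module.isTorsionFree_iff_smul_eq_zero]
    intro n q hq
    obtain ⟨a, rfl⟩ := P.mkQ_surjective q
    by_cases hn : n = 0
    · exact Or.inl hn
    · right
      rw [← map_smul, Submodule.mkQ_apply, Submodule.Quotient.mk_eq_zero] at hq
      rw [Submodule.mkQ_apply, Submodule.Quotient.mk_eq_zero]
      exact tf n a hn hq
  -- The quotient is finitely generated and torsion-free over ℤ, hence free, so the projection
  -- splits; the coefficient of `e` in `a - σ [a]` is a first retraction `ρ`.
  obtain ⟨σ, hσ⟩ := Module.projective_lifting_property P.mkQ LinearMap.id P.mkQ_surjective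
  have hsub (a : A) : ∃ n : ℤ, n • e = a - σ (P.mkQ a) := by
    rw [← Submodule.mem_span_singleton, ← hP, ← Submodule.Quotient.mk_eq_zero,
      ← Submodule.mkQ_apply, map_sub]
    have := LinearMap.congr_fun hσ (P.mkQ a)
    simp only [LinearMap.comp_apply, LinearMap.id_apply] at this
    rw [this, sub_self]
  have hinj : ∀ m n : ℤ, m • e = n • e → m = n := fun m n hmn =>
    sub_eq_zero.1 (he _ (by rw [sub_smul, hmn, sub_self]))
  choose r hr using hsub
  let ρ : A →ₗ[ℤ] ℤ := AddMonoidHom.toIntLinearMap <| AddMonoidHom.mk' r fun a b => hinj _ _ <| by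
    rw [add_smul, hr, hr, hr, map_add, map_add]; abel
  have hρ : ρ e = 1 := hinj _ _ <| by
    have : P.mkQ e = 0 := by simp [hP, Submodule.mem_span_singleton_self]
    show r e • e = _
    rw [hr, this, map_zero, sub_zero, one_smul]
  -- Functionals on the free quotient separate points. Adding multiples of such a `μ` to a
  -- retraction keeps its value 1 at `e`.
  have hμ (d : A) (hd : d ∉ P) : ∃ μ : A →ₗ[ℤ] ℤ, μ e = 0 ∧ μ d ≠ 0 := by
    have hne : P.mkQ d ≠ 0 := by
      rwa [Submodule.mkQ_apply, Ne, Submodule.Quotient.mk_eq_zero]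
    by_contra! H
    refine hne ((Module.forall_dual_apply_eq_zero_iff ℤ _).1 fun f => H (f ∘ₗ P.mkQ) ?_)
    have : P.mkQ e = 0 := by simp [hP, Submodule.mem_span_singleton_self]
    rw [LinearMap.comp_apply, this, map_zero]
  obtain ⟨h, he1, hh⟩ : ∃ h : A →ₗ[ℤ] ℤ, h e = 1 ∧ ∀ d ∈ D, h d ≠ 0 := by
    induction D using Finset.induction_on with
    | empty => exact ⟨ρ, hρ, by simp⟩
    | insert d D _ ih =>
      obtain ⟨h, he1, hh⟩ := ih fun d hd' => hD d (Finset.mem_insert_of_mem hd')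
      obtain ⟨μ, hμe, hμd⟩ := hμ d (hD d (Finset.mem_insert_self _ _))
      obtain ⟨c, hc⟩ := (finite_setOf_exists_affine_eq_zero h μ (insert d D) (by
        simp only [Finset.mem_insert]
        rintro a (rfl | ha)
        exacts [Or.inr hμd, Or.inl (hh a ha)])).exists_notMem
      refine ⟨h + c • μ, by simp [he1, hμe], fun a ha h0 => hc ⟨a, ha, by simpa using h0⟩⟩
  obtain ⟨μ, hμe, hμx⟩ := hμ x hx
  -- A whole half-line of `c` makes the value at `x` small enough, and only finitely many `c` create
  -- a zero on `D`.
  have hinf : {c : ℤ | h x + c * μ x < K}.Infinite := by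
    rcases lt_or_gt_of_ne hμx with hneg | hpos
    · refine (Set.Ioi_infinite (max 0 (h x - K))).mono fun c hc => ?_
      simp only [Set.mem_Ioi, max_lt_iff] at hc
      simp only [Set.mem_ofPred_eq]
      nlinarith
    · refine (Set.Iio_infinite (min 0 (K - h x))).mono fun c hc => ?_
      simp only [Set.mem_Iio, lt_min_iff] at hc
      simp only [Set.mem_ofPred_eq]
      nlinarith
  obtain ⟨c, hcK, hc⟩ := hinf.exists_notMem_finite
    (finite_setOf_exists_affine_eq_zero h μ D fun d hd => Or.inl (hh d hd))
  exact ⟨h + c • μ, by simp [he1, hμe], fun d hd h0 => hc ⟨d, hd, by simpa using h0⟩,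
    by simpa using hcK⟩

/-- A version of `exists_retraction` for finitely many elements of a group that need not be finitely
generated. -/
theorem exists_partial_retraction {e : A} (he : ∀ n : ℤ, n • e = 0 → n = 0)
    (tf : ∀ (n : ℤ) (a : A), n ≠ 0 → n • a ∈ Submodule.span ℤ {e} → a ∈ Submodule.span ℤ {e})
    (S : Finset A) {x : A} (hxS : x ∈ S) (hx : x ∉ Submodule.span ℤ {e}) (K : ℤ) :
    ∃ h : A → ℤ, (∀ a ∈ S, ∀ b ∈ S, h (a + b) = h a + h b) ∧
      (∀ a ∈ S, ∀ n : ℤ, h (a + n • e) = h a + n) ∧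
      Set.InjOn h S ∧ h x < K := by
  classical
  set G := Submodule.span ℤ (insert e S : Set A) with hG
  have heG : e ∈ G := Submodule.subset_span (Set.mem_insert _ _)
  have hSG : ∀ a ∈ S, a ∈ G := fun a ha => Submodule.subset_span (Set.mem_insert_of_mem _ ha)
  have : Module.Finite ℤ G := Module.Finite.span_of_finite ℤ (S.finite_toSet.insert e)
  have hspan (a : G) : a ∈ Submodule.span ℤ {(⟨e, heG⟩ : G)} ↔ (a : A) ∈ Submodule.span ℤ {e} := by
    simp [Submodule.mem_span_singleton, Subtype.ext_iff]
  obtain ⟨h, h1, hD, hK⟩ := exists_retraction (e := (⟨e, heG⟩ : G))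
    (fun n hn => he n (by simpa [Subtype.ext_iff] using hn))
    (fun n a hn ha => (hspan a).2 (tf n a hn ((hspan _).1 ha)))
    -- Injectivity on `S` asks that differences not be killed: those outside ℤ e are put into `D`,
    -- and on ℤ e itself `h` reads off the coefficient.
    ((((S ×ˢ S).image fun p => p.1 - p.2).subtype (· ∈ G)).filter
      (· ∉ Submodule.span ℤ {(⟨e, heG⟩ : G)})) (fun d hd => (Finset.mem_filter.1 hd).2)
    (x := ⟨x, hSG x hxS⟩) (fun hx' => hx ((hspan _).1 hx')) K
  have hadd : ∀ a (ha : a ∈ G) b (hb : b ∈ G),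
      h ⟨a + b, G.add_mem ha hb⟩ = h ⟨a, ha⟩ + h ⟨b, hb⟩ := fun a ha b hb =>
    map_add h ⟨a, ha⟩ ⟨b, hb⟩
  have hsmul : ∀ n : ℤ, h ⟨n • e, G.smul_mem n heG⟩ = n := fun n => by
    have := map_smul h n ⟨e, heG⟩
    rw [h1, smul_eq_mul, mul_one] at this
    exact this
  refine ⟨fun a => if ha : a ∈ G then h ⟨a, ha⟩ else 0, fun a ha b hb => ?_, fun a ha n => ?_,
    fun a ha b hb hab => ?_, ?_⟩
  · simp only [hSG a ha, hSG b hb, G.add_mem (hSG a ha) (hSG b hb), dite_true, hadd]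
  · have hn := G.smul_mem n heG
    simp only [hSG a ha, G.add_mem (hSG a ha) hn, dite_true]
    rw [hadd a (hSG a ha) _ hn, hsmul]
  · have ha' := Finset.mem_coe.1 ha
    have hb' := Finset.mem_coe.1 hb
    replace ha := hSG a ha
    replace hb := hSG b hb
    simp only [ha, hb, dite_true] at hab
    by_cases hs : a - b ∈ Submodule.span ℤ {e}
    · obtain ⟨n, hn⟩ := Submodule.mem_span_singleton.1 hs
      obtain rfl : a = b + n • e := by rw [hn]; abel
      rw [hadd b hb _ (G.smul_mem n heG), hsmul] at hab
      obtain rfl : n = 0 := by linarith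
      simp
    · refine absurd (by rw [map_sub, hab, sub_self]) (hD (⟨a, ha⟩ - ⟨b, hb⟩) ?_)
      rw [Finset.mem_filter, hspan, Finset.mem_subtype]
      exact ⟨Finset.mem_image.2 ⟨(a, b), Finset.mem_product.2 ⟨ha', hb'⟩, rfl⟩, hs⟩
  · simpa only [hSG x hxS, dite_true] using hK

end Retraction

/-! ### Soundness and monotonicity -/

section Soundness

variable {L : FirstOrder.Language.{0, 0}}

theorem realize_inst {N : Type} [L.Structure N] (φ : L.BoundedFormula ℕ 1) (t : L.Term ℕ)
    (v : ℕ → N) : (inst φ t).Realize v ↔ φ.Realize v fun _ => t.realize v := by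
  simp only [inst, Formula.Realize, BoundedFormula.realize_subst]
  exact BoundedFormula.realize_toFormula φ _

theorem realize_congr_of_eqOn {α : Type} [DecidableEq α] {N : Type} [L.Structure N] {n : ℕ}
    (φ : L.BoundedFormula α n) {v w : α → N} {xs : Fin n → N}
    (h : ∀ a ∈ φ.freeVarFinset, v a = w a) : φ.Realize v xs ↔ φ.Realize w xs := by
  rw [← BoundedFormula.realize_restrictFreeVar (f := id) (v := fun a => v a) v (by simp),
    BoundedFormula.realize_restrictFreeVar w (by simpa using h)]

theorem snoc_default_eq_const {N : Type} (a : N) :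
    (Fin.snoc (default : Fin 0 → N) a : Fin 1 → N) = fun _ => a := by
  funext i
  obtain rfl : i = Fin.last 0 := Fin.ext (by omega)
  rw [Fin.snoc_last]

theorem Derivable.realize {T : L.Theory} {φ : L.Formula ℕ} (h : Derivable T φ) {N : Type}
    [L.Structure N] (hN : N ⊨ T) (v : ℕ → N) : φ.Realize v := by
  induction h generalizing v with
  | @axm σ h =>
    rw [Formula.realize_relabel, Subsingleton.elim (v ∘ Empty.elim) default]
    exact hN.realize_of_mem σ h
  | imp_k φ ψ => simp only [Formula.realize_imp]; tauto
  | imp_s φ ψ χ => simp only [Formula.realize_imp]; tauto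
  | not_not φ => simp only [Formula.realize_imp, Formula.realize_not]; tauto
  | mp _ _ h₁ h₂ => exact Formula.realize_imp.1 (h₁ v) (h₂ v)
  | all_elim φ t =>
    rw [Formula.realize_imp, realize_inst]
    intro h
    rw [← snoc_default_eq_const]
    exact h (t.realize v)
  | @all_intro ψ φ a hψ hφ _ ih =>
    rw [Formula.realize_imp]
    intro hv x
    -- The eigenvariable `a` occurs in neither `ψ` nor `φ`, so reassigning it to `x` disturbs
    -- neither.
    have := Formula.realize_imp.1 (ih (Function.update v a x))
      ((realize_congr_of_eqOn ψ fun b hb => ?_).1 hv)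
    · rw [realize_inst, realize_congr_of_eqOn φ (w := v)] at this
      · simpa [snoc_default_eq_const] using this
      · intro b hb
        exact Function.update_of_ne (by grind) _ _
    · exact (Function.update_of_ne (by grind) _ _).symm
  | eq_refl t => simp [Formula.Realize, Term.equal]
  | eq_subst φ s t =>
    simp only [Formula.realize_imp, realize_inst, Formula.realize_equal]
    intro h
    rw [h]; exact id

theorem Proves.realize {T : L.Theory} {σ : L.Sentence} (h : Proves T σ) {N : Type}
    [L.Structure N] [Nonempty N] (hN : N ⊨ T) : N ⊨ σ := by
  have := Derivable.realize h hN fun _ => Classical.arbitrary N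
  rwa [Formula.realize_relabel, Subsingleton.elim (_ ∘ Empty.elim) default] at this

theorem Derivable.mono {T T' : L.Theory} (hT : T ⊆ T') {φ : L.Formula ℕ} (h : Derivable T φ) :
    Derivable T' φ := by
  induction h with
  | axm h => exact .axm (hT h)
  | imp_k φ ψ => exact .imp_k φ ψ
  | imp_s φ ψ χ => exact .imp_s φ ψ χ
  | not_not φ => exact .not_not φ
  | mp _ _ h₁ h₂ => exact .mp h₁ h₂
  | all_elim φ t => exact .all_elim φ t
  | all_intro hψ hφ _ ih => exact .all_intro hψ hφ ih
  | eq_refl t => exact .eq_refl t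
  | eq_subst φ s t => exact .eq_subst φ s t

theorem Proves.mono {T T' : L.Theory} (hT : T ⊆ T') {σ : L.Sentence} (h : Proves T σ) :
    Proves T' σ := Derivable.mono hT h

theorem unnested_mono {T T' : L.Theory} (hT : T ⊆ T') (R : InferenceRule L) :
    unnested T R ⊆ unnested T' R := by
  rintro σ (h | ⟨Γ, hΓ, h⟩)
  exacts [Or.inl (hT h), Or.inr ⟨Γ, hΓ, fun γ hγ => (h γ hγ).mono hT⟩]

theorem nestedUpTo_mono {T T' : L.Theory} (hT : T ⊆ T') (R : InferenceRule L) (n : ℕ) :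
    nestedUpTo T R n ⊆ nestedUpTo T' R n := by
  induction n with
  | zero => exact hT
  | succ n ih => exact unnested_mono ih R

theorem addRule_mono {T T' : L.Theory} (hT : T ⊆ T') (R : InferenceRule L) :
    addRule T R ⊆ addRule T' R :=
  Set.iUnion_mono fun n => nestedUpTo_mono hT R n

theorem subset_addRule (T : L.Theory) (R : InferenceRule L) : T ⊆ addRule T R :=
  Set.subset_iUnion (nestedUpTo T R) 0

theorem realize_forallClosure {N : Type} [L.Structure N] (φ : L.Formula (Fin 1)) :
    N ⊨ forallClosure φ ↔ ∀ a : N, φ.Realize fun _ => a := by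
  refine (BoundedFormula.realize_alls (n := 1)).trans ⟨fun h a => ?_, fun h xs => ?_⟩
  · exact (Formula.realize_relabel_sumInr φ).1 (h fun _ => a)
  · have : xs = fun _ => xs 0 := funext fun i => by rw [Subsingleton.elim i 0]
    rw [this]
    exact (Formula.realize_relabel_sumInr φ).2 (h (xs 0))

end Soundness

/-! ### Preservation of existential formulas under finite partial embeddings -/

section PartialEmbedding

variable {L : FirstOrder.Language.{0, 0}} {N N' : Type} [L.Structure N] [L.Structure N']

/-- `f` restricts to an isomorphism of the partial structure induced on `S` with the one induced on
its image. -/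
structure IsPartialEmbeddingOn (L : FirstOrder.Language.{0, 0}) {N N' : Type} [L.Structure N]
    [L.Structure N'] (f : N → N') (S : Set N) : Prop where
  injOn : Set.InjOn f S
  map_fun : ∀ {n : ℕ} (F : L.Functions n) (x : Fin n → N), (∀ i, x i ∈ S) →
    Structure.funMap F x ∈ S → f (Structure.funMap F x) = Structure.funMap F (f ∘ x)
  map_rel : ∀ {n : ℕ} (r : L.Relations n) (x : Fin n → N), (∀ i, x i ∈ S) →
    (Structure.RelMap r (f ∘ x) ↔ Structure.RelMap r x)

theorem IsPartialEmbeddingOn.mono {f : N → N'} {S S' : Set N} (h : IsPartialEmbeddingOn L f S)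
    (hS : S' ⊆ S) : IsPartialEmbeddingOn L f S' where
  injOn := h.injOn.mono hS
  map_fun F x hx hF := h.map_fun F x (fun i => hS (hx i)) (hS hF)
  map_rel r x hx := h.map_rel r x fun i => hS (hx i)

/-- `S` collects the values of all subterms, so `f` respects each step of the evaluation. -/
theorem exists_finset_realize_term {α : Type} (t : L.Term α) (v : α → N) :
    ∃ S : Finset N, t.realize v ∈ S ∧ ∀ f : N → N', IsPartialEmbeddingOn L f S →
      t.realize (f ∘ v) = f (t.realize v) := by
  classical
  induction t with
  | var a => exact ⟨{v a}, by simp, fun f _ => rfl⟩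
  | func F ts ih =>
    choose S hmem hS using ih
    refine ⟨insert ((Term.func F ts).realize v) (Finset.univ.biUnion S), by simp, fun f hf => ?_⟩
    have hsub (i) : (S i : Set N) ⊆
        (insert ((Term.func F ts).realize v) (Finset.univ.biUnion S) : Finset N) := by
      intro a ha
      simp only [Finset.coe_insert, Finset.coe_biUnion]
      exact Or.inr (Set.mem_biUnion (Finset.mem_coe.2 (Finset.mem_univ i)) ha)
    simp only [Term.realize_func]
    rw [hf.map_fun F _ (fun i => hsub i (hmem i)) (by simp)]
    congr 1
    exact funext fun i => hS i f (hf.mono (hsub i))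

/-- Injectivity makes `f` reflect equalities as well as preserve them; the equivalence, rather than
one direction, is what passes through implications. -/
theorem exists_finset_realize_of_isQF {α : Type} {n : ℕ} {φ : L.BoundedFormula α n} (hφ : φ.IsQF)
    (v : α → N) (xs : Fin n → N) :
    ∃ S : Finset N, ∀ f : N → N', IsPartialEmbeddingOn L f S →
      (φ.Realize (f ∘ v) (f ∘ xs) ↔ φ.Realize v xs) := by
  classical
  induction hφ with
  | falsum => exact ⟨∅, fun _ _ => Iff.rfl⟩
  | of_isAtomic h =>
    cases h with
    | equal t₁ t₂ =>
      obtain ⟨S₁, hm₁, hS₁⟩ := exists_finset_realize_term (N' := N') t₁ (Sum.elim v xs)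
      obtain ⟨S₂, hm₂, hS₂⟩ := exists_finset_realize_term (N' := N') t₂ (Sum.elim v xs)
      refine ⟨S₁ ∪ S₂, fun f hf => ?_⟩
      rw [BoundedFormula.realize_bdEqual, BoundedFormula.realize_bdEqual, ← Sum.comp_elim,
        hS₁ f (hf.mono (by simp)), hS₂ f (hf.mono (by simp))]
      exact hf.injOn.eq_iff (by simp [hm₁]) (by simp [hm₂])
    | rel r ts =>
      choose S hmem hS using fun i =>
        exists_finset_realize_term (N' := N') (ts i) (Sum.elim v xs)
      refine ⟨Finset.univ.biUnion S, fun f hf => ?_⟩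
      have hsub (i) : (S i : Set N) ⊆ (Finset.univ.biUnion S : Finset N) := by
        exact_mod_cast Finset.subset_biUnion_of_mem S (Finset.mem_univ i)
      rw [BoundedFormula.realize_rel, BoundedFormula.realize_rel, ← Sum.comp_elim,
        ← hf.map_rel r _ fun i => hsub i (hmem i)]
      exact iff_of_eq (congrArg _ (funext fun i => hS i f (hf.mono (hsub i))))
  | imp _ _ ih₁ ih₂ =>
    obtain ⟨S₁, hS₁⟩ := ih₁
    obtain ⟨S₂, hS₂⟩ := ih₂
    refine ⟨S₁ ∪ S₂, fun f hf => ?_⟩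
    rw [BoundedFormula.realize_imp, BoundedFormula.realize_imp, hS₁ f (hf.mono (by simp)),
      hS₂ f (hf.mono (by simp))]

theorem exists_finset_realize_of_isExistential {α : Type} {n : ℕ} {φ : L.BoundedFormula α n}
    (hφ : φ.IsExistential) (v : α → N) (xs : Fin n → N) (h : φ.Realize v xs) :
    ∃ S : Finset N, ∀ f : N → N', IsPartialEmbeddingOn L f S → φ.Realize (f ∘ v) (f ∘ xs) := by
  induction hφ with
  | of_isQF hφ =>
    obtain ⟨S, hS⟩ := exists_finset_realize_of_isQF (N' := N') hφ v xs
    exact ⟨S, fun f hf => (hS f hf).2 h⟩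
  | ex _ ih =>
    obtain ⟨a, ha⟩ := BoundedFormula.realize_ex.1 h
    obtain ⟨S, hS⟩ := ih _ ha
    refine ⟨S, fun f hf => BoundedFormula.realize_ex.2 ⟨f a, ?_⟩⟩
    rw [← Fin.comp_snoc]
    exact hS f hf

end PartialEmbedding

/-! ### The ultrapower of the standard model -/

section Ultrapower

open Filter

/-- The ultrapower of the standard model `M 0` by a nonprincipal ultrafilter on `ℕ`. -/
abbrev StdUltrapower : Type := (hyperfilter ℕ : Filter ℕ).Product fun _ => M 0

/-- The germs of sequences of integers along the ultrafilter that defines `StdUltrapower`. -/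
abbrev IntGerm : Type := Germ (hyperfilter ℕ : Filter ℕ) ℤ

/-- Division by `n` is exact on a large set of indices. This makes the germs modulo the constants ℤ
torsion-free, as the retraction requires. -/
theorem exists_eq_intCast_of_zsmul_eq {n : ℤ} (hn : n ≠ 0) {g : IntGerm} {k : ℤ}
    (h : n • g = (k : IntGerm)) : ∃ j : ℤ, g = (j : IntGerm) := by
  induction g using Germ.inductionOn with | _ f => ?_
  have h' : ∀ᶠ i in (hyperfilter ℕ : Filter ℕ), n * f i = k := Germ.coe_eq.1 h
  refine ⟨k / n, Germ.coe_eq.2 (h'.mono fun i hi => ?_)⟩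
  exact (Int.ediv_eq_of_eq_mul_right hn hi.symm).symm

theorem exists_eq_intCast_of_bounded {f : ℕ → ℤ} {k : ℤ}
    (h : ∀ᶠ i in (hyperfilter ℕ : Filter ℕ), 0 ≤ f i ∧ f i ≤ k) :
    ∃ j : ℤ, (f : IntGerm) = (j : IntGerm) := by
  obtain ⟨j, -, hj⟩ := (Ultrafilter.eventually_exists_mem_iff (P := fun j i => f i = j)
    (Set.finite_Icc 0 k)).1 (h.mono fun i hi => ⟨f i, hi, rfl⟩)
  exact ⟨j, Germ.coe_eq.2 hj⟩

theorem M.fst_eq_zero (a : M 0) : a.1.1 = 0 := Nat.le_zero.1 a.2.1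

theorem M.ext_zero {a b : M 0} (h : a.1.2 = b.1.2) : a = b :=
  Subtype.ext (Prod.ext (a.fst_eq_zero.trans b.fst_eq_zero.symm) h)

namespace StdUltrapower

/-- The nonstandard integer that an element of `StdUltrapower` stands for. -/
noncomputable def value : StdUltrapower → IntGerm :=
  Quotient.map' (fun (a : ℕ → M 0) i => (a i).1.2) fun _ _ h =>
    h.mono fun _ hi => congrArg (fun b : M 0 => b.1.2) hi

theorem value_injective : Function.Injective value := by
  intro a b
  induction a using Quotient.inductionOn with | _ a => ?_
  induction b using Quotient.inductionOn with | _ b => ?_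
  intro h
  exact Quotient.sound ((Germ.coe_eq.1 h).mono fun i hi => M.ext_zero hi)

/-- An element of `StdUltrapower` is standard if it stands for an integer. -/
def IsStd (a : StdUltrapower) : Prop := ∃ n : ℤ, value a = (n : IntGerm)

theorem nonneg_of_value_eq {a : StdUltrapower} {n : ℤ} (h : value a = (n : IntGerm)) : 0 ≤ n := by
  induction a using Quotient.inductionOn with | _ a => ?_
  have h' : ∀ᶠ i in (hyperfilter ℕ : Filter ℕ), (a i).1.2 = n := Germ.coe_eq.1 h
  obtain ⟨i, hi⟩ := h'.exists
  rw [← hi]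
  exact (a i).2.2 (a i).fst_eq_zero

theorem value_funMap_zero (x : Fin 0 → StdUltrapower) :
    value (Structure.funMap (L := LA) Func.zero x) = 0 := by
  obtain rfl : x = fun i => Quotient.mk _ (Fin.elim0 i : ℕ → M 0) := Subsingleton.elim _ _
  exact congrArg value (Ultraproduct.funMap_cast (L := LA) Func.zero _)

theorem value_funMap_succ (x : Fin 1 → StdUltrapower) :
    value (Structure.funMap (L := LA) Func.succ x) = value (x 0) + 1 := by
  obtain ⟨y, rfl⟩ : ∃ y : Fin 1 → ℕ → M 0, x = fun i => Quotient.mk _ (y i) :=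
    ⟨fun i => (x i).out, funext fun i => (Quotient.out_eq _).symm⟩
  exact congrArg value (Ultraproduct.funMap_cast (L := LA) Func.succ _)

theorem value_funMap_add (x : Fin 2 → StdUltrapower) :
    value (Structure.funMap (L := LA) Func.add x) = value (x 0) + value (x 1) := by
  obtain ⟨y, rfl⟩ : ∃ y : Fin 2 → ℕ → M 0, x = fun i => Quotient.mk _ (y i) :=
    ⟨fun i => (x i).out, funext fun i => (Quotient.out_eq _).symm⟩
  exact congrArg value (Ultraproduct.funMap_cast (L := LA) Func.add _)

theorem value_funMap_pred (x : Fin 1 → StdUltrapower) :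
    value (Structure.funMap (L := LA) Func.pred x) = (value (x 0)).map fun n => max (n - 1) 0 := by
  obtain ⟨y, rfl⟩ : ∃ y : Fin 1 → ℕ → M 0, x = fun i => Quotient.mk _ (y i) :=
    ⟨fun i => (x i).out, funext fun i => (Quotient.out_eq _).symm⟩
  refine (congrArg value (Ultraproduct.funMap_cast (L := LA) Func.pred _)).trans ?_
  refine Germ.coe_eq.2 (Eventually.of_forall fun i => ?_)
  exact if_pos (y 0 i).fst_eq_zero

theorem value_funMap_pred_of_not_isStd {x : Fin 1 → StdUltrapower} (hx : ¬ IsStd (x 0)) :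
    value (Structure.funMap (L := LA) Func.pred x) = value (x 0) - 1 := by
  rw [value_funMap_pred]
  generalize x 0 = a at hx
  induction a using Quotient.inductionOn with | _ a => ?_
  -- A nonstandard value is positive almost everywhere, so the truncation of `p` at 0 has no effect.
  have h0 : ∀ᶠ i in (hyperfilter ℕ : Filter ℕ), (a i).1.2 ≠ 0 :=
    Ultrafilter.eventually_not.2 fun h => hx ⟨0, Germ.coe_eq.2 (h.mono fun i hi => by simpa using hi)⟩
  refine Germ.coe_eq.2 (h0.mono fun i hi => ?_)
  have := (a i).2.2 (a i).fst_eq_zero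
  change max ((a i).1.2 - 1) 0 = (a i).1.2 - 1
  omega

/-- Both summands are nonnegative, so a standard sum bounds them, and a bounded germ is constant. -/
theorem isStd_left_of_value_add {a b : StdUltrapower} {n : ℤ}
    (h : value a + value b = (n : IntGerm)) : IsStd a := by
  induction a using Quotient.inductionOn with | _ a => ?_
  induction b using Quotient.inductionOn with | _ b => ?_
  have h' : ∀ᶠ i in (hyperfilter ℕ : Filter ℕ), (a i).1.2 + (b i).1.2 = n := Germ.coe_eq.1 h
  refine exists_eq_intCast_of_bounded (k := n) (h'.mono fun i hi => ?_)
  have := (a i).2.2 (a i).fst_eq_zero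
  have := (b i).2.2 (b i).fst_eq_zero
  change 0 ≤ (a i).1.2 ∧ (a i).1.2 ≤ n
  omega

/-- The element of `StdUltrapower` given by the sequence of all natural numbers. -/
noncomputable def infinite : StdUltrapower :=
  Quotient.mk _ fun i => (⟨(0, (i : ℤ)), le_rfl, fun _ => by simp⟩ : M 0)

theorem not_isStd_infinite : ¬ IsStd infinite := by
  rintro ⟨n, hn⟩
  have h' : ∀ᶠ i : ℕ in (hyperfilter ℕ : Filter ℕ), (i : ℤ) = n := Germ.coe_eq.1 hn
  have hfin : {i : ℕ | (i : ℤ) = n}.Finite :=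
    Set.Subsingleton.finite fun i hi j hj => by simp_all; omega
  exact hfin.notMem_hyperfilter h'

open Classical in
/-- The map to `M I` that is the identity on standard elements and sends a nonstandard element `a`
to the element `h (value a)` of the chain `m`. -/
noncomputable def toM {I m : ℕ} (hm : 1 ≤ m) (hI : m ≤ I) (h : IntGerm → ℤ) (a : StdUltrapower) :
    M I :=
  if ha : IsStd a then ⟨(0, ha.choose), Nat.zero_le _, fun _ => nonneg_of_value_eq ha.choose_spec⟩
  else ⟨(m, h (value a)), hI, fun h0 => absurd h0 (by simp only; omega)⟩

variable {I m : ℕ} (hm : 1 ≤ m) (hI : m ≤ I) (h : IntGerm → ℤ)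

theorem toM_of_value_eq {a : StdUltrapower} {n : ℤ} (ha : value a = (n : IntGerm)) :
    (toM hm hI h a).1 = (0, n) := by
  have hs : IsStd a := ⟨n, ha⟩
  have : hs.choose = n := Germ.const_inj.1 (hs.choose_spec.symm.trans ha)
  simp [toM, hs, this]

theorem toM_of_not_isStd {a : StdUltrapower} (ha : ¬ IsStd a) :
    (toM hm hI h a).1 = (m, h (value a)) := by
  simp [toM, ha]

theorem isPartialEmbeddingOn_toM {S : Set StdUltrapower}
    (hinj : Set.InjOn h (value '' S))
    (hadd : ∀ a ∈ S, ∀ b ∈ S, h (value a + value b) = h (value a) + h (value b))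
    (hint : ∀ a ∈ S, ∀ n : ℤ, h (value a + n) = h (value a) + n) :
    IsPartialEmbeddingOn LA (toM hm hI h) S where
  injOn := by
    intro a ha b hb hab
    replace hab := congrArg Subtype.val hab
    by_cases hsa : IsStd a <;> by_cases hsb : IsStd b
    · obtain ⟨n, hn⟩ := hsa
      obtain ⟨k, hk⟩ := hsb
      rw [toM_of_value_eq hm hI h hn, toM_of_value_eq hm hI h hk, Prod.mk.injEq] at hab
      exact value_injective (by rw [hn, hk, hab.2])
    · obtain ⟨n, hn⟩ := hsa
      rw [toM_of_value_eq hm hI h hn, toM_of_not_isStd hm hI h hsb, Prod.mk.injEq] at hab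
      omega
    · obtain ⟨n, hn⟩ := hsb
      rw [toM_of_value_eq hm hI h hn, toM_of_not_isStd hm hI h hsa, Prod.mk.injEq] at hab
      omega
    · rw [toM_of_not_isStd hm hI h hsa, toM_of_not_isStd hm hI h hsb, Prod.mk.injEq] at hab
      exact value_injective
        (hinj (Set.mem_image_of_mem _ ha) (Set.mem_image_of_mem _ hb) hab.2)
  map_rel r := r.elim
  map_fun F x hx _ := by
    apply Subtype.ext
    cases F with
    | zero => exact toM_of_value_eq hm hI h (n := 0) (by rw [value_funMap_zero, Int.cast_zero])
    | succ =>
      change _ = ((toM hm hI h (x 0)).1.1, (toM hm hI h (x 0)).1.2 + 1)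
      by_cases hs : IsStd (x 0)
      · obtain ⟨n, hn⟩ := hs
        rw [toM_of_value_eq hm hI h hn]
        exact toM_of_value_eq hm hI h (by rw [value_funMap_succ, hn]; push_cast; rfl)
      · rw [toM_of_not_isStd hm hI h hs, toM_of_not_isStd, value_funMap_succ]
        · simpa using hint _ (hx 0) 1
        · rintro ⟨n, hn⟩
          rw [value_funMap_succ] at hn
          exact hs ⟨n - 1, by rw [Int.cast_sub, ← hn]; simp⟩
    | pred =>
      change _ = ((toM hm hI h (x 0)).1.1, if (toM hm hI h (x 0)).1.1 = 0 then
        max ((toM hm hI h (x 0)).1.2 - 1) 0 else (toM hm hI h (x 0)).1.2 - 1)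
      by_cases hs : IsStd (x 0)
      · obtain ⟨n, hn⟩ := hs
        rw [toM_of_value_eq hm hI h hn]
        exact toM_of_value_eq hm hI h (by rw [value_funMap_pred, hn]; rfl)
      · rw [toM_of_not_isStd hm hI h hs, toM_of_not_isStd, value_funMap_pred_of_not_isStd hs]
        · have := hint _ (hx 0) (-1)
          rw [Int.cast_neg, Int.cast_one, ← sub_eq_add_neg] at this
          rw [this, if_neg (by simp only; omega)]
          rfl
        · rintro ⟨n, hn⟩
          rw [value_funMap_pred_of_not_isStd hs] at hn
          exact hs ⟨n + 1, by rw [Int.cast_add, ← hn]; simp⟩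
    | add =>
      change _ = (typeOp (toM hm hI h (x 0)).1.1 (toM hm hI h (x 1)).1.1,
        (toM hm hI h (x 0)).1.2 + (toM hm hI h (x 1)).1.2)
      have hm0 : m ≠ 0 := by omega
      by_cases hs₀ : IsStd (x 0) <;> by_cases hs₁ : IsStd (x 1)
      · obtain ⟨n, hn⟩ := hs₀
        obtain ⟨k, hk⟩ := hs₁
        rw [toM_of_value_eq hm hI h hn, toM_of_value_eq hm hI h hk]
        exact toM_of_value_eq hm hI h (by rw [value_funMap_add, hn, hk]; push_cast; rfl)
      all_goals
        -- No cancellation is possible: one nonstandard summand makes the sum nonstandard, so its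
        -- image lies in chain `m`, as `typeOp` demands.
        have hns : ¬ IsStd (Structure.funMap (L := LA) Func.add x) := by
          rintro ⟨n, hn⟩
          rw [value_funMap_add] at hn
          have h₀ := isStd_left_of_value_add hn
          rw [add_comm] at hn
          have h₁ := isStd_left_of_value_add hn
          contradiction
        rw [toM_of_not_isStd hm hI h hns, value_funMap_add]
      · obtain ⟨n, hn⟩ := hs₀
        rw [toM_of_value_eq hm hI h hn, toM_of_not_isStd hm hI h hs₁, hn, add_comm,
          hint _ (hx 1) n, add_comm]
        simp [typeOp]
      · obtain ⟨n, hn⟩ := hs₁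
        rw [toM_of_value_eq hm hI h hn, toM_of_not_isStd hm hI h hs₀, hn, hint _ (hx 0) n]
        simp [typeOp, hm0]
      · rw [toM_of_not_isStd hm hI h hs₀, toM_of_not_isStd hm hI h hs₁, hadd _ (hx 0) _ (hx 1)]
        simp [typeOp, hm0]

end StdUltrapower

/-! ### Transfer of existential formulas to the nonstandard chains -/

instance (I : ℕ) : Nonempty (M I) := ⟨M.zero⟩

open StdUltrapower in
/-- If an existential formula holds at all standard numbers, it holds arbitrarily far down in every
nonstandard chain of `M I`. -/
theorem exists_lt_realize_of_forall_realize {I m : ℕ} (hm : 1 ≤ m) (hI : m ≤ I)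
    {γ : LA.Formula (Fin 1)} (hγ : BoundedFormula.IsExistential γ)
    (hstd : ∀ a : M 0, γ.Realize fun _ => a) (K : ℤ) :
    ∃ a : M I, a.1.1 = m ∧ a.1.2 < K ∧ γ.Realize fun _ => a := by
  classical
  have hinf : γ.Realize fun _ => infinite :=
    (Ultraproduct.realize_formula_cast γ _).2 (Eventually.of_forall fun i => hstd _)
  obtain ⟨S, hS⟩ := exists_finset_realize_of_isExistential (N' := M I) hγ _ _ hinf
  have hspan (g : IntGerm) : g ∈ Submodule.span ℤ {(1 : IntGerm)} ↔ ∃ n : ℤ, g = (n : IntGerm) := by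
    simp only [Submodule.mem_span_singleton, zsmul_one, eq_comm]
  obtain ⟨h, hadd, hint, hinj, hK⟩ := exists_partial_retraction (e := (1 : IntGerm))
    (fun n hn => Germ.const_inj.1 (by rw [zsmul_one] at hn; exact hn))
    (fun n a hn ha => by
      rw [hspan] at ha ⊢
      obtain ⟨k, hk⟩ := ha
      exact exists_eq_intCast_of_zsmul_eq hn hk)
    ((insert infinite S).image value) (x := value infinite) (by simp)
    (fun hx => not_isStd_infinite ((hspan _).1 hx)) K
  have hmem : ∀ a ∈ (S : Set StdUltrapower), value a ∈ (insert infinite S).image value :=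
    fun a ha => Finset.mem_image_of_mem _ (Finset.mem_insert_of_mem ha)
  refine ⟨toM hm hI h infinite, ?_, ?_, ?_⟩
  · rw [toM_of_not_isStd hm hI h not_isStd_infinite]
  · rwa [toM_of_not_isStd hm hI h not_isStd_infinite]
  · have := hS (toM hm hI h) (isPartialEmbeddingOn_toM hm hI h ?_ ?_ ?_)
    · rw [Subsingleton.elim (_ ∘ default) default] at this
      exact this
    · refine hinj.mono ?_
      rintro _ ⟨a, ha, rfl⟩
      exact hmem a ha
    · exact fun a ha b hb => hadd _ (hmem a ha) _ (hmem b hb)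
    · intro a ha n
      rw [← hint _ (hmem a ha) n, zsmul_one]

end Ultrapower

/-! ### The structures `M I` are closed under the induction rule -/

section Models

variable {I : ℕ}

theorem realize_zeroT {α : Type} (v : α → M I) : (zeroT : LA.Term α).realize v = M.zero := rfl

theorem realize_succT {α : Type} (t : LA.Term α) (v : α → M I) :
    (succT t).realize v = M.succ (t.realize v) := rfl

theorem realize_predT {α : Type} (t : LA.Term α) (v : α → M I) :
    (predT t).realize v = M.pred (t.realize v) := rfl

theorem realize_addT {α : Type} (t u : LA.Term α) (v : α → M I) :
    (addT t u).realize v = M.add (t.realize v) (u.realize v) := rfl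

theorem models_axiomB2_iff : M I ⊨ axiomB2 ↔ ∀ a b : M I, M.add a b = M.add b a := by
  simp [axiomB2, Sentence.Realize, Formula.Realize, realize_addT, Fin.snoc]

/-- Associativity survives because either bracketing takes the first nonzero type among the three
summands. -/
theorem models_baseB_union_axiomB3 : M I ⊨ baseB ∪ {axiomB3} := by
  rw [Theory.model_iff]
  rintro σ ((rfl | rfl | rfl | rfl | rfl) | rfl) <;>
    simp [axiomB3, Sentence.Realize, Formula.Realize, realize_addT, realize_succT,
      realize_predT, realize_zeroT, Fin.snoc, M.zero, M.succ, M.pred, M.add,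
      typeOp]
  · exact fun h => absurd (congrArg (fun a : M I => a.1.2) h) one_ne_zero
  · rfl
  · refine fun a => Subtype.ext (Prod.ext rfl ?_)
    have := a.2.2
    simp only
    split_ifs <;> grind
  · refine fun a => Subtype.ext (Prod.ext ?_ rfl)
    simp only
    split_ifs <;> grind
  · exact fun a b => Subtype.ext (Prod.ext rfl (add_assoc _ _ _).symm)
  · refine fun a b c => Subtype.ext (Prod.ext ?_ (add_assoc _ _ _).symm)
    simp only
    split_ifs <;> simp_all

/-- The induction step only moves upwards and a nonstandard chain has no least element, so starting
points arbitrarily far down are needed. -/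
theorem realize_of_induction {γ : LA.Formula (Fin 1)} (h0 : γ.Realize fun _ => (M.zero : M I))
    (hs : ∀ a : M I, γ.Realize (fun _ => a) → γ.Realize fun _ => M.succ a)
    (hns : ∀ m, 1 ≤ m → m ≤ I → ∀ K : ℤ,
      ∃ a : M I, a.1.1 = m ∧ a.1.2 < K ∧ γ.Realize fun _ => a) (a : M I) :
    γ.Realize fun _ => a := by
  have key : ∀ (n : ℕ) (a b : M I), (γ.Realize fun _ => a) → b.1 = (a.1.1, a.1.2 + n) →
      γ.Realize fun _ => b := by
    intro n
    induction n with
    | zero =>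
      intro a b ha hb
      obtain rfl : b = a := Subtype.ext (by simpa using hb)
      exact ha
    | succ n ih =>
      intro a b ha hb
      exact ih (M.succ a) b (hs a ha) (by rw [hb]; simp only [M.succ]; push_cast; ring_nf)
  by_cases ha : a.1.1 = 0
  · obtain ⟨n, hn⟩ := Int.eq_ofNat_of_zero_le (a.2.2 ha)
    exact key n M.zero a h0 (Prod.ext ha (by simp [M.zero, hn]))
  · obtain ⟨b, hb, hlt, hγ⟩ := hns a.1.1 (by omega) a.2.1 a.1.2
    exact key (a.1.2 - b.1.2).toNat b a hγ (Prod.ext hb.symm (by simp only; omega))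

/-- All `I` are treated at once: the conclusion in `M I` uses the premises both there and in `M 0`.
-/
theorem models_nestedUpTo {T : LA.Theory} (hT : ∀ I, M I ⊨ T) (n : ℕ) :
    ∀ I, M I ⊨ nestedUpTo T (parameterFreeInductionRule existsOne) n := by
  induction n with
  | zero => exact hT
  | succ n ih =>
    intro I
    rw [Theory.model_iff]
    rintro σ (hσ | ⟨Γ, ⟨γ, hγ, hi⟩, hΓ⟩)
    · exact (ih I).realize_of_mem σ hσ
    · obtain ⟨rfl, rfl⟩ := Prod.mk.inj hi
      have h0 (J) : γ.Realize fun _ => (M.zero : M J) := by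
        have := (hΓ _ List.mem_cons_self).realize (ih J)
        exact BoundedFormula.realize_subst.1 this
      have hs (J) (a : M J) : γ.Realize (fun _ => a) → γ.Realize fun _ => M.succ a := by
        have := (realize_forallClosure _).1 ((hΓ _ (List.mem_cons_of_mem _ List.mem_cons_self)).realize (ih J)) a
        rw [Formula.realize_imp] at this
        exact fun ha => BoundedFormula.realize_subst.1 (this ha)
      -- `M 0` has no nonstandard chains, so ordinary induction suffices.
      have hstd := realize_of_induction (h0 0) (hs 0) fun m hm hm' => by omega
      exact (realize_forallClosure γ).2 <| realize_of_induction (h0 I) (hs I)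
        fun m hm hm' K => exists_lt_realize_of_forall_realize hm hm' hγ hstd K

theorem models_addRule {T : LA.Theory} (hT : ∀ I, M I ⊨ T) (I : ℕ) :
    M I ⊨ addRule T (parameterFreeInductionRule existsOne) := by
  rw [Theory.model_iff]
  intro σ hσ
  obtain ⟨n, hn⟩ := Set.mem_iUnion.1 hσ
  exact (models_nestedUpTo hT n I).realize_of_mem σ hn

theorem not_models_axiomB2 : ¬ M 2 ⊨ axiomB2 := by
  rw [models_axiomB2_iff]
  intro h
  have := congrArg (fun a => a.1.1)
    (h ⟨(1, 0), by simp⟩ ⟨(2, 0), by simp⟩)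
  simp [M.add, typeOp] at this

end Models

end LinArith

theorem mainTheorem11 :
    ¬ LinArith.Proves
        (LinArith.addRule (LinArith.baseB ∪ {LinArith.axiomB3})
          (LinArith.parameterFreeInductionRule LinArith.existsOne))
        LinArith.axiomB2 ∧
    (LinArith.M 2 ⊨ LinArith.addRule (LinArith.baseB ∪ {LinArith.axiomB3})
          (LinArith.parameterFreeInductionRule LinArith.existsOne) ∧
      ¬ LinArith.M 2 ⊨ LinArith.axiomB2) ∧
    {σ : LinArith.LA.Sentence | LinArith.Proves
        (LinArith.addRule (LinArith.baseB ∪ {LinArith.axiomB3})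
          (LinArith.parameterFreeInductionRule LinArith.existsOne)) σ} ⊂
      {σ : LinArith.LA.Sentence | LinArith.Proves
        (LinArith.addRule (LinArith.baseB ∪ {LinArith.axiomB2, LinArith.axiomB3})
          (LinArith.parameterFreeInductionRule LinArith.existsOne)) σ} := by
  have hM := LinArith.models_addRule (fun _ => LinArith.models_baseB_union_axiomB3) 2
  have hB2 := LinArith.not_models_axiomB2
  have hnot : ¬ LinArith.Proves _ LinArith.axiomB2 := fun h => hB2 (h.realize hM)
  refine ⟨hnot, ⟨hM, hB2⟩, fun σ h => ?_, fun h => hnot (h ?_)⟩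
  · refine LinArith.Proves.mono (LinArith.addRule_mono ?_ _) h
    exact Set.union_subset_union_right _ (by simp)
  · exact LinArith.Derivable.axm (LinArith.subset_addRule _ _ (by simp))
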